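/- Let $G$ be a finite tree (undirected, without loops) on $n \ge 1$ vertices, with $0/1$ adjacency matrix $A$, degree vector $d = A\mathbf 1$ and distance matrix $\Delta = (\delta_{i,j})$, where $\delta_{i,j}$ is the graph distance between the vertices $i$ and $j$. Let $k$ be a vertex of $G$, let $w > 0$ be real, and let $G(k,w)$ be the weighted graph obtained from $G$ by adding a loop of weight $w$ at $k$, i.e. the weighted graph with adjacency matrix $\hat A = A + w\, e_k e_k^{\top}$, where $e_k$ is the $k$-th unit vector. Let $P = \hat D^{-1}\hat A$, with $\hat D = \mathrm{diag}(\hat A \mathbf 1)$, be the transition matrix of the random walk on $G(k,w)$. For an irreducible stochastic matrix $P$ with stationary distribution $\pi$, Kemeny's constant is $\kappa(P) = \sum_{j} \pi_j\, m_{i,j}$, where $m_{i,j} = \mathbb E_i[\min\{t \ge 0 : X_t = j\}]$ is the expected time in which the Markov chain $(X_t)$ with transition matrix $P$ started at $i$ hits $j$ (so $m_{j,j}=0$); the sum does not depend on $i$. Put $\kappa(G(k,w)) = \kappa(P)$. Then $P$ is stochastic and irreducible, its Kemeny constant is well defined, and $$\kappa(G(k,w)) = \frac{d^{\top}\Delta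 d + 2w\, d^{\top}\Delta e_k}{2(2n-2+w)}.$$ -/

import Mathlib

open scoped Matrix

noncomputable section

namespace Kemeny

variable {V : Type*} [Fintype V] [DecidableEq V]

/-- The distance matrix of a graph. -/
def distMatrix (G : SimpleGraph V) : Matrix V V ℝ :=
  Matrix.of fun i j => (G.dist i j : ℝ)

/-- The (weighted) degree vector `A 𝟙` of the weighted graph with adjacency matrix `A`. -/
def degVec (A : Matrix V V ℝ) : V → ℝ := A *ᵥ 1

/-- The adjacency matrix of the weighted graph `G(k, w)`, obtained from the graph `G` by
adding a loop of weight `w` at the vertex `k`. -/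
def loopAdjMatrix (G : SimpleGraph V) [DecidableRel G.Adj] (k : V) (w : ℝ) : Matrix V V ℝ :=
  G.adjMatrix ℝ + Matrix.single k k w

/-- The transition matrix `P = D⁻¹ A`, `D = diag (A 𝟙)`, of the random walk on the weighted
graph with adjacency matrix `A`. -/
def transitionMatrix (A : Matrix V V ℝ) : Matrix V V ℝ :=
  Matrix.diagonal (fun i => (degVec A i)⁻¹) * A

/-- For the Markov chain `(X_t)` with transition matrix `P`, the probability, given `X_0 = i`,
that `X_0, …, X_t` all differ from `j`. This is the probability that `T_j > t`, where
`T_j = min {t ≥ 0 | X_t = j}` is the hitting time of `j`. -/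
def probNotHit (P : Matrix V V ℝ) (j : V) : ℕ → V → ℝ
  | 0, i => if i = j then 0 else 1
  | t + 1, i => if i = j then 0 else ∑ l, P i l * probNotHit P j t l

/-- `h` is the (finite) expected hitting time of `j` for the chain started at `i`:
`E_i[T_j] = ∑_{t ≥ 0} Pr_i(T_j > t)`. In particular it is `0` for `i = j`. -/
def HasMeanHittingTime (P : Matrix V V ℝ) (i j : V) (h : ℝ) : Prop :=
  HasSum (fun t : ℕ => probNotHit P j t i) h

/-- `π` is a stationary distribution of `P`. -/
def IsStationary (P : Matrix V V ℝ) (π : V → ℝ) : Prop :=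
  (∀ i, 0 ≤ π i) ∧ π ⬝ᵥ 1 = 1 ∧ π ᵥ* P = π

/-- `κ` is Kemeny's constant of the irreducible stochastic matrix `P`: from every initial state
`i`, the expected time to reach a state `j` chosen at random according to the stationary
distribution `π` is `∑ j, π j * E_i[T_j] = κ`. -/
def IsKemenyConstant (P : Matrix V V ℝ) (κ : ℝ) : Prop :=
  P ∈ Matrix.rowStochastic ℝ V ∧ P.IsIrreducible ∧
    ∃ (π : V → ℝ) (m : V → V → ℝ), IsStationary P π ∧
      (∀ i j, HasMeanHittingTime P i j (m i j)) ∧ ∀ i, ∑ j, π j * m i j = κ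

end Kemeny

end

/-! Let `a` be the degree vector of `G(k, w)`. The mean hitting times are guessed explicitly: `m i j
= ½ ∑ z, a z * (δ i j + δ j z - δ i z)`. The factor `½ (δ i j + δ j z - δ i z)` counts the edges of
the path from `i` to `j` that separate `z` from `j`. The guess satisfies the one-step equations
(`treeHittingTime_step`) because the Laplacian of a distance function on a tree is explicit
(`sum_adjMatrix_mul_dist_sub`) and ignores loops. Being nonnegative, it gives the true hitting times
(`hasMeanHittingTime_of_step`). Averaging over `π = a / vol` cancels all dependence on `i` and
leaves `aᵀ Δ a / (2 vol)`. Finally `a = d + w e_k`, `vol = 2n - 2 + w` and `δ k k = 0`. -/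

namespace Kemeny

/-! ### Hitting times from the one-step equations. -/

section HittingTime

variable {V : Type*} [Fintype V] [DecidableEq V]

lemma probNotHit_self (P : Matrix V V ℝ) (j : V) (t : ℕ) : probNotHit P j t j = 0 := by
  cases t <;> simp [probNotHit]

lemma probNotHit_succ_of_ne (P : Matrix V V ℝ) {i j : V} (hij : i ≠ j) (t : ℕ) :
    probNotHit P j (t + 1) i = ∑ l, P i l * probNotHit P j t l := by
  simp [probNotHit, hij]

lemma probNotHit_nonneg {P : Matrix V V ℝ} (hP : ∀ i l, 0 ≤ P i l) (j : V) (t : ℕ) (i : V) :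
    0 ≤ probNotHit P j t i := by
  induction t generalizing i with
  | zero => simp only [probNotHit]; split_ifs <;> norm_num
  | succ t ih =>
    simp only [probNotHit]
    split_ifs
    · rfl
    · exact Finset.sum_nonneg fun l _ => mul_nonneg (hP i l) (ih l)

/-- The remainder `h - ∑ s < t, Pr(T_j > s)` is obtained from `h` by `t` steps of the chain
killed at `j`. -/
lemma remainder_succ {P : Matrix V V ℝ} {j : V} {h : V → ℝ}
    (hstep : ∀ i, i ≠ j → h i = 1 + ∑ l, P i l * h l) {i : V} (hij : i ≠ j) (t : ℕ) :
    h i - ∑ s ∈ Finset.range (t + 1), probNotHit P j s i =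
      ∑ l, P i l * (h l - ∑ s ∈ Finset.range t, probNotHit P j s l) := by
  have h0 : probNotHit P j 0 i = 1 := by simp [probNotHit, hij]
  rw [Finset.sum_range_succ', h0, hstep i hij]
  simp only [probNotHit_succ_of_ne P hij, mul_sub, Finset.sum_sub_distrib, Finset.mul_sum]
  rw [Finset.sum_comm]
  ring

/-- A nonnegative solution of the one-step equations for the hitting time of `j` is the vector
of mean hitting times of `j`. -/
lemma hasMeanHittingTime_of_step {P : Matrix V V ℝ} (hP : ∀ i l, 0 ≤ P i l) {j : V} {h : V → ℝ}
    (hnonneg : ∀ i, 0 ≤ h i) (hj : h j = 0)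
    (hstep : ∀ i, i ≠ j → h i = 1 + ∑ l, P i l * h l) (i : V) :
    HasMeanHittingTime P i j (h i) := by
  set S : ℕ → V → ℝ := fun t i => ∑ s ∈ Finset.range t, probNotHit P j s i with hS
  have hSj : ∀ t, S t j = 0 := fun t => by simp [hS, probNotHit_self]
  have hlower : ∀ t i, 0 ≤ h i - S t i := by
    intro t
    induction t with
    | zero => simpa [hS] using hnonneg
    | succ t ih =>
      intro i
      by_cases hij : i = j
      · subst hij; simp [hSj, hj]
      · simp only [hS]
        rw [remainder_succ hstep hij]
        exact Finset.sum_nonneg fun l _ => mul_nonneg (hP i l) (ih l)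
  have hC : ∀ i, h i ≤ ∑ l, h l := fun i =>
    Finset.single_le_sum (fun l _ => hnonneg l) (Finset.mem_univ i)
  -- The partial sums are bounded by `h i`, so the survival probabilities are summable and tend to
  -- `0`; this bound then forces the remainder to `0`.
  have hupper : ∀ t i, h i - S t i ≤ (∑ l, h l) * probNotHit P j t i := by
    intro t
    induction t with
    | zero =>
      intro i
      by_cases hij : i = j
      · subst hij; simp [hSj, hj, probNotHit_self]
      · simpa [hS, probNotHit, hij] using hC i
    | succ t ih =>
      intro i
      by_cases hij : i = j
      · subst hij; simp [hSj, hj, probNotHit_self]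
      · simp only [hS]
        rw [remainder_succ hstep hij, probNotHit_succ_of_ne P hij, Finset.mul_sum]
        refine Finset.sum_le_sum fun l _ => ?_
        rw [mul_left_comm]
        exact mul_le_mul_of_nonneg_left (ih l) (hP i l)
  have hsum : Summable fun t => probNotHit P j t i :=
    summable_of_sum_range_le (fun t => probNotHit_nonneg hP j t i)
      fun t => sub_nonneg.mp (hlower t i)
  have hrem : Filter.Tendsto (fun t => h i - S t i) Filter.atTop (nhds 0) := by
    refine squeeze_zero (fun t => hlower t i) (fun t => hupper t i) ?_
    simpa using hsum.tendsto_atTop_zero.const_mul (∑ l, h l)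
  refine (hsum.hasSum_iff_tendsto_nat).mpr ?_
  simpa using (tendsto_const_nhds (x := h i)).sub hrem

end HittingTime

/-! ### Random walks on weighted graphs. -/

section WeightedGraph

variable {V : Type*} [Fintype V]

lemma degVec_apply (A : Matrix V V ℝ) (i : V) : degVec A i = ∑ l, A i l := by
  simp [degVec, Matrix.mulVec, dotProduct]

variable [DecidableEq V]

lemma transitionMatrix_apply (A : Matrix V V ℝ) (i l : V) :
    transitionMatrix A i l = (degVec A i)⁻¹ * A i l := by
  simp [transitionMatrix, Matrix.diagonal_mul]

lemma transitionMatrix_nonneg {A : Matrix V V ℝ} (hA : ∀ i l, 0 ≤ A i l) (i l : V) :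
    0 ≤ transitionMatrix A i l := by
  rw [transitionMatrix_apply, degVec_apply]
  exact mul_nonneg (inv_nonneg.mpr (Finset.sum_nonneg fun l _ => hA i l)) (hA i l)

lemma transitionMatrix_mem_rowStochastic {A : Matrix V V ℝ} (hA : ∀ i l, 0 ≤ A i l)
    (hdeg : ∀ i, 0 < degVec A i) : transitionMatrix A ∈ Matrix.rowStochastic ℝ V := by
  refine Matrix.mem_rowStochastic_iff_sum.mpr ⟨transitionMatrix_nonneg hA, fun i => ?_⟩
  simp only [transitionMatrix_apply]
  rw [← Finset.mul_sum, ← degVec_apply, inv_mul_cancel₀ (hdeg i).ne']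

/-- The random walk on an undirected weighted graph is stationary for the distribution
proportional to the degrees. -/
lemma isStationary_transitionMatrix [Nonempty V] {A : Matrix V V ℝ} (hsymm : ∀ i l, A i l = A l i)
    (hdeg : ∀ i, 0 < degVec A i) :
    IsStationary (transitionMatrix A) fun i => degVec A i / ∑ l, degVec A l := by
  have hvol : 0 < ∑ l, degVec A l :=
    Finset.sum_pos (fun i _ => hdeg i) Finset.univ_nonempty
  refine ⟨fun i => div_nonneg (hdeg i).le hvol.le, ?_, ?_⟩
  · simp only [dotProduct, Pi.one_apply, mul_one]
    rw [← Finset.sum_div, div_self hvol.ne']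
  · ext l
    simp only [Matrix.vecMul, dotProduct, transitionMatrix_apply]
    rw [degVec_apply A l, Finset.sum_div]
    refine Finset.sum_congr rfl fun i _ => ?_
    have := (hdeg i).ne'
    rw [hsymm l i]
    field_simp

end WeightedGraph

/-! ### Distances in trees. -/

section Tree

variable {V : Type*} {G : SimpleGraph V}

/-- In a tree, exactly one neighbour of `i` is nearer to `z ≠ i` than `i`; all other neighbours
are farther away. -/
lemma exists_adj_dist_of_ne [DecidableEq V] (hG : G.IsTree) {i z : V} (hiz : i ≠ z) :
    ∃ u, G.Adj i u ∧
      ∀ l, G.Adj i l → (G.dist l z : ℝ) - G.dist i z = 1 - if l = u then 2 else 0 := by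
  obtain ⟨p, hp, hlen⟩ := hG.connected.exists_path_of_dist i z
  have hnil : ¬ p.Nil := SimpleGraph.Walk.not_nil_of_ne hiz
  -- A nearer neighbour `l` begins a geodesic from `i` to `z`, and the path between two vertices of
  -- a tree is unique.
  have hunique : ∀ l, G.Adj i l → G.dist i z = G.dist l z + 1 → l = p.snd := by
    intro l hl hd
    obtain ⟨q, -, hq⟩ := hG.connected.exists_path_of_dist l z
    have hcons : (SimpleGraph.Walk.cons hl q).IsPath :=
      SimpleGraph.Walk.isPath_of_length_eq_dist _ (by simp [hq, hd])
    have heq := (hG.existsUnique_path i z).unique hcons hp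
    rw [← heq]
    simp
  have hadj : G.Adj i p.snd := p.adj_snd hnil
  refine ⟨p.snd, hadj, fun l hl => ?_⟩
  by_cases hlu : l = p.snd
  · have h1 : G.dist l z ≤ p.tail.length := by
      rw [hlu]
      exact SimpleGraph.dist_le p.tail
    have h2 := SimpleGraph.Walk.length_tail_add_one hnil
    have h3 := hG.dist_eq_dist_add_one_of_adj z hl
    rw [SimpleGraph.dist_comm (u := z), SimpleGraph.dist_comm (u := z)] at h3
    have h4 : G.dist i z = G.dist l z + 1 := by omega
    rw [h4, if_pos hlu]
    push_cast
    ring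
  · have h3 := hG.dist_eq_dist_add_one_of_adj z hl
    rw [SimpleGraph.dist_comm (u := z), SimpleGraph.dist_comm (u := z)] at h3
    have h4 := h3.resolve_left fun h => hlu (hunique l hl h)
    rw [h4, if_neg hlu]
    push_cast
    ring

variable [Fintype V] [DecidableRel G.Adj]

/-- The Laplacian of the distance function of a tree. -/
lemma sum_adjMatrix_mul_dist_sub [DecidableEq V] (hG : G.IsTree) (i z : V) :
    ∑ l, G.adjMatrix ℝ i l * ((G.dist l z : ℝ) - G.dist i z) =
      degVec (G.adjMatrix ℝ) i - 2 + if i = z then 2 else 0 := by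
  rw [degVec_apply]
  by_cases hiz : i = z
  · subst hiz
    rw [if_pos rfl, sub_add_cancel]
    refine Finset.sum_congr rfl fun l _ => ?_
    by_cases hl : G.Adj i l
    · simp [SimpleGraph.dist_eq_one_iff_adj.mpr hl.symm]
    · simp [hl]
  · obtain ⟨u, hu, hdist⟩ := exists_adj_dist_of_ne hG hiz
    have hterm : ∀ l, G.adjMatrix ℝ i l * ((G.dist l z : ℝ) - G.dist i z) =
        G.adjMatrix ℝ i l - if l = u then 2 else 0 := by
      intro l
      by_cases hl : G.Adj i l
      · simp [hl, hdist l hl]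
      · have : l ≠ u := fun h => hl (h ▸ hu)
        simp [hl, this]
    simp [hterm, hiz, Finset.sum_sub_distrib, -SimpleGraph.adjMatrix_apply]

lemma sum_degVec_adjMatrix (hG : G.IsTree) :
    ∑ i, degVec (G.adjMatrix ℝ) i = 2 * (Fintype.card V : ℝ) - 2 := by
  have h1 : ∀ i, degVec (G.adjMatrix ℝ) i = (G.degree i : ℝ) := fun i => by
    simp [degVec_apply, SimpleGraph.adjMatrix_apply, ← SimpleGraph.card_neighborFinset_eq_degree,
      SimpleGraph.neighborFinset_eq_filter]
  simp only [h1]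
  have h2 := G.sum_degrees_eq_twice_card_edges
  have h3 := hG.card_edgeFinset
  rw [← h3, ← Nat.cast_sum, h2]
  push_cast
  ring

end Tree

/-! ### The tree with a loop at `k`. -/

section Loop

variable {V : Type*} [DecidableEq V] {G : SimpleGraph V} [DecidableRel G.Adj]
  {k : V} {w : ℝ}

lemma loopAdjMatrix_apply (i l : V) :
    loopAdjMatrix G k w i l = G.adjMatrix ℝ i l + if i = k ∧ l = k then w else 0 := by
  simp [loopAdjMatrix, Matrix.single_apply, eq_comm]

lemma loopAdjMatrix_symm (i l : V) : loopAdjMatrix G k w i l = loopAdjMatrix G k w l i := by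
  simp [loopAdjMatrix_apply, SimpleGraph.adj_comm, and_comm]

lemma loopAdjMatrix_nonneg (hw : 0 ≤ w) (i l : V) : 0 ≤ loopAdjMatrix G k w i l := by
  rw [loopAdjMatrix_apply, SimpleGraph.adjMatrix_apply]
  split_ifs <;> positivity

lemma loopAdjMatrix_pos_of_adj (hw : 0 ≤ w) {i l : V} (h : G.Adj i l) :
    0 < loopAdjMatrix G k w i l := by
  rw [loopAdjMatrix_apply, SimpleGraph.adjMatrix_apply, if_pos h]
  split_ifs <;> positivity

lemma loopAdjMatrix_loop_pos (hw : 0 < w) : 0 < loopAdjMatrix G k w k k := by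
  simpa [loopAdjMatrix_apply] using hw

variable [Fintype V]

lemma degVec_loopAdjMatrix (i : V) :
    degVec (loopAdjMatrix G k w) i = degVec (G.adjMatrix ℝ) i + if i = k then w else 0 := by
  simp only [degVec_apply, loopAdjMatrix_apply, Finset.sum_add_distrib]
  by_cases h : i = k <;> simp [h]

lemma degVec_loopAdjMatrix_pos (hG : G.Connected) (hw : 0 < w) (i : V) :
    0 < degVec (loopAdjMatrix G k w) i := by
  rw [degVec_apply]
  have key : ∃ l, 0 < loopAdjMatrix G k w i l := by
    -- If the tree is a single vertex, only the loop makes the degree positive.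
    by_cases hik : i = k
    · exact ⟨k, hik ▸ loopAdjMatrix_loop_pos hw⟩
    · obtain ⟨p⟩ := hG i k
      exact ⟨p.snd, loopAdjMatrix_pos_of_adj hw.le
        (p.adj_snd (SimpleGraph.Walk.not_nil_of_ne hik))⟩
  obtain ⟨l, hl⟩ := key
  exact Finset.sum_pos' (fun l _ => loopAdjMatrix_nonneg hw.le i l) ⟨l, Finset.mem_univ l, hl⟩

lemma isIrreducible_transitionMatrix_loopAdjMatrix (hG : G.Connected) (hw : 0 < w) :
    (transitionMatrix (loopAdjMatrix G k w)).IsIrreducible := by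
  refine ⟨transitionMatrix_nonneg (loopAdjMatrix_nonneg hw.le), ?_⟩
  let : Quiver V := (transitionMatrix (loopAdjMatrix G k w)).toQuiver
  have hpos : ∀ i l, 0 < loopAdjMatrix G k w i l → Nonempty (i ⟶ l) := fun i l h =>
    ⟨⟨by
      rw [transitionMatrix_apply]
      exact mul_pos (inv_pos.mpr (degVec_loopAdjMatrix_pos hG hw i)) h⟩⟩
  have hpath : ∀ i j : V, Nonempty (Quiver.Path i j) := by
    intro i j
    obtain ⟨p⟩ := hG i j
    induction p with
    | nil => exact ⟨Quiver.Path.nil⟩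
    | cons h _ ih =>
      obtain ⟨e⟩ := hpos _ _ (loopAdjMatrix_pos_of_adj hw.le h)
      obtain ⟨q⟩ := ih
      exact ⟨e.toPath.comp q⟩
  intro i j
  obtain ⟨p⟩ := hpath i k
  obtain ⟨q⟩ := hpath k j
  obtain ⟨e⟩ := hpos k k (loopAdjMatrix_loop_pos hw)
  -- Irreducibility asks for a path of positive length, also when `i = j`; the detour through the
  -- loop at `k` provides it.
  exact ⟨(p.cons e).comp q, by simp⟩

/-- The mean hitting times of the random walk on `G(k, w)`, `G` a tree. -/
noncomputable def treeHittingTime (G : SimpleGraph V) [DecidableRel G.Adj] (k : V) (w : ℝ) (i j : V) : ℝ :=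
  (∑ z, degVec (loopAdjMatrix G k w) z *
    ((G.dist i j : ℝ) + G.dist j z - G.dist i z)) / 2

lemma treeHittingTime_nonneg (hG : G.Connected) (hw : 0 < w) (i j : V) :
    0 ≤ treeHittingTime G k w i j := by
  refine div_nonneg (Finset.sum_nonneg fun z _ => ?_) zero_le_two
  refine mul_nonneg (degVec_loopAdjMatrix_pos hG hw z).le (sub_nonneg.mpr ?_)
  exact_mod_cast hG.dist_triangle

lemma treeHittingTime_self (j : V) : treeHittingTime G k w j j = 0 := by
  simp [treeHittingTime]

/-- The loop contributes `w * (f k - f k) = 0`, so the Laplacian does not see it. -/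
lemma sum_loopAdjMatrix_mul_sub (f : V → ℝ) (i : V) :
    ∑ l, loopAdjMatrix G k w i l * (f l - f i) = ∑ l, G.adjMatrix ℝ i l * (f l - f i) := by
  refine Finset.sum_congr rfl fun l _ => ?_
  rw [loopAdjMatrix_apply]
  by_cases h : i = k ∧ l = k
  · simp [h.1, h.2]
  · simp [h]

/-- The Laplacians of the distances to `j` and to `z` share the part `d i - 2`, which cancels; since
`i ≠ j`, only the term `z = i` survives. -/
lemma sum_loopAdjMatrix_mul_treeHittingTime_sub (hG : G.IsTree) {i j : V} (hij : i ≠ j) :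
    ∑ l, loopAdjMatrix G k w i l * (treeHittingTime G k w l j - treeHittingTime G k w i j) =
      -degVec (loopAdjMatrix G k w) i := by
  rw [sum_loopAdjMatrix_mul_sub fun l => treeHittingTime G k w l j]
  have hdiff : ∀ l, treeHittingTime G k w l j - treeHittingTime G k w i j =
      (∑ z, degVec (loopAdjMatrix G k w) z *
        (((G.dist l j : ℝ) - G.dist i j) - ((G.dist l z : ℝ) - G.dist i z))) / 2 := by
    intro l
    rw [treeHittingTime, treeHittingTime, ← sub_div, ← Finset.sum_sub_distrib]
    congr 1
    exact Finset.sum_congr rfl fun z _ => by ring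
  simp only [hdiff, mul_div_assoc', Finset.mul_sum]
  rw [← Finset.sum_div, Finset.sum_comm]
  have hinner : ∀ z, ∑ l, G.adjMatrix ℝ i l * (degVec (loopAdjMatrix G k w) z *
        (((G.dist l j : ℝ) - G.dist i j) - ((G.dist l z : ℝ) - G.dist i z))) =
      -(if i = z then 2 * degVec (loopAdjMatrix G k w) z else 0) := by
    intro z
    have h1 := sum_adjMatrix_mul_dist_sub hG i j
    have h2 := sum_adjMatrix_mul_dist_sub hG i z
    rw [if_neg hij] at h1
    calc _ = degVec (loopAdjMatrix G k w) z *
          (∑ l, G.adjMatrix ℝ i l * ((G.dist l j : ℝ) - G.dist i j) -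
            ∑ l, G.adjMatrix ℝ i l * ((G.dist l z : ℝ) - G.dist i z)) := by
          rw [← Finset.sum_sub_distrib, Finset.mul_sum]
          exact Finset.sum_congr rfl fun l _ => by ring
      _ = _ := by
          rw [h1, h2]
          split_ifs <;> ring
  simp only [hinner, Finset.sum_neg_distrib, Finset.sum_ite_eq, Finset.mem_univ, if_true]
  ring

lemma treeHittingTime_step (hG : G.IsTree) (hw : 0 < w) {i j : V} (hij : i ≠ j) :
    treeHittingTime G k w i j = 1 + ∑ l, transitionMatrix (loopAdjMatrix G k w) i l *
      treeHittingTime G k w l j := by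
  have hdeg := degVec_loopAdjMatrix_pos (k := k) hG.connected hw i
  have h := sum_loopAdjMatrix_mul_treeHittingTime_sub (k := k) (w := w) hG hij
  simp only [mul_sub, Finset.sum_sub_distrib] at h
  rw [← Finset.sum_mul, ← degVec_apply] at h
  simp only [transitionMatrix_apply, mul_assoc]
  rw [← Finset.mul_sum, sub_eq_iff_eq_add.mp h]
  field_simp
  ring

lemma sum_degVec_mul_treeHittingTime (i : V) :
    ∑ j, degVec (loopAdjMatrix G k w) j * treeHittingTime G k w i j =
      (∑ j, ∑ z, degVec (loopAdjMatrix G k w) j * degVec (loopAdjMatrix G k w) z *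
        (G.dist j z : ℝ)) / 2 := by
  set a := degVec (loopAdjMatrix G k w)
  -- Exchanging `j` and `z` cancels the two sums that involve `i`, hence the result is independent
  -- of `i`.
  have hswap : ∑ j, ∑ z, a j * a z * (G.dist i z : ℝ) = ∑ j, ∑ z, a j * a z * (G.dist i j : ℝ) := by
    rw [Finset.sum_comm]
    exact Finset.sum_congr rfl fun _ _ => Finset.sum_congr rfl fun _ _ => by ring
  have hexp : ∑ j, a j * treeHittingTime G k w i j = (∑ j, ∑ z, a j * a z * (G.dist i j : ℝ) +
      ∑ j, ∑ z, a j * a z * (G.dist j z : ℝ) - ∑ j, ∑ z, a j * a z * (G.dist i z : ℝ)) / 2 := by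
    simp only [← Finset.sum_add_distrib, ← Finset.sum_sub_distrib]
    rw [Finset.sum_div]
    refine Finset.sum_congr rfl fun j _ => ?_
    rw [treeHittingTime, mul_div_assoc', Finset.mul_sum]
    congr 1
    exact Finset.sum_congr rfl fun z _ => by ring
  rw [hexp, hswap]
  ring

lemma sum_degVec_mul_degVec_mul_dist :
    ∑ j, ∑ z, degVec (loopAdjMatrix G k w) j * degVec (loopAdjMatrix G k w) z *
        (G.dist j z : ℝ) =
      degVec (G.adjMatrix ℝ) ⬝ᵥ (distMatrix G *ᵥ degVec (G.adjMatrix ℝ)) +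
        2 * w * (degVec (G.adjMatrix ℝ) ⬝ᵥ (distMatrix G *ᵥ (Pi.single k 1 : V → ℝ))) := by
  set d := degVec (G.adjMatrix ℝ)
  have hterm : ∀ j z, degVec (loopAdjMatrix G k w) j * degVec (loopAdjMatrix G k w) z *
      (G.dist j z : ℝ) = d j * ((G.dist j z : ℝ) * d z) +
        (if z = k then w * (d j * (G.dist j z : ℝ)) else 0) +
        (if j = k then w * (d z * (G.dist z j : ℝ)) else 0) := by
    intro j z
    rw [degVec_loopAdjMatrix, degVec_loopAdjMatrix, G.dist_comm (u := z)]
    -- At `j = z = k` both conditionals apply and a `w²` term appears, but everything is multiplied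
    -- by `G.dist k k = 0`.
    by_cases hj : j = k <;> by_cases hz : z = k
    · simp [hj, hz]
    all_goals simp only [hj, hz, if_true, if_false]; ring
  have hsingle : d ⬝ᵥ (distMatrix G *ᵥ (Pi.single k 1 : V → ℝ)) =
      ∑ j, d j * (G.dist j k : ℝ) := by
    simp [dotProduct, distMatrix]
  have hdd : d ⬝ᵥ (distMatrix G *ᵥ d) = ∑ j, ∑ z, d j * ((G.dist j z : ℝ) * d z) := by
    simp [dotProduct, Matrix.mulVec, distMatrix, Finset.mul_sum]
  have hlast : ∑ j, ∑ z, (if j = k then w * (d z * (G.dist z j : ℝ)) else 0) =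
      w * ∑ z, d z * (G.dist z k : ℝ) := by
    rw [Finset.sum_comm]
    simp [Finset.mul_sum]
  have hmid : ∑ j, ∑ z, (if z = k then w * (d j * (G.dist j z : ℝ)) else 0) =
      w * ∑ j, d j * (G.dist j k : ℝ) := by
    simp [Finset.mul_sum]
  simp only [hterm, Finset.sum_add_distrib]
  rw [hlast, hmid, hsingle, hdd]
  ring

end Loop

end Kemeny

theorem mainTheorem6 {V : Type*} [Fintype V] [DecidableEq V]
    (G : SimpleGraph V) [DecidableRel G.Adj] (hG : G.IsTree) (k : V) (w : ℝ) (hw : 0 < w) :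
    Kemeny.IsKemenyConstant
      (Kemeny.transitionMatrix (Kemeny.loopAdjMatrix G k w))
      ((Kemeny.degVec (G.adjMatrix ℝ) ⬝ᵥ
            (Kemeny.distMatrix G *ᵥ Kemeny.degVec (G.adjMatrix ℝ)) +
          2 * w * (Kemeny.degVec (G.adjMatrix ℝ) ⬝ᵥ
            (Kemeny.distMatrix G *ᵥ (Pi.single k 1 : V → ℝ)))) /
        (2 * (2 * (Fintype.card V : ℝ) - 2 + w))) := by
  have hA := Kemeny.loopAdjMatrix_nonneg (G := G) (k := k) hw.le
  have hdeg := Kemeny.degVec_loopAdjMatrix_pos (k := k) hG.connected hw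
  have : Nonempty V := ⟨k⟩
  refine ⟨Kemeny.transitionMatrix_mem_rowStochastic hA hdeg,
    Kemeny.isIrreducible_transitionMatrix_loopAdjMatrix hG.connected hw,
    _, Kemeny.treeHittingTime G k w,
    Kemeny.isStationary_transitionMatrix Kemeny.loopAdjMatrix_symm hdeg, fun i j =>
      Kemeny.hasMeanHittingTime_of_step (h := fun i => Kemeny.treeHittingTime G k w i j)
        (Kemeny.transitionMatrix_nonneg hA)
        (fun i => Kemeny.treeHittingTime_nonneg hG.connected hw i j)
        (Kemeny.treeHittingTime_self j)
        (fun i hij => Kemeny.treeHittingTime_step hG hw hij) i, fun i => ?_⟩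
  have hvol : ∑ l, Kemeny.degVec (Kemeny.loopAdjMatrix G k w) l =
      2 * (Fintype.card V : ℝ) - 2 + w := by
    simp only [Kemeny.degVec_loopAdjMatrix, Finset.sum_add_distrib, Kemeny.sum_degVec_adjMatrix hG,
      Finset.sum_ite_eq', Finset.mem_univ, if_true]
  simp only [div_mul_eq_mul_div]
  rw [← Finset.sum_div, Kemeny.sum_degVec_mul_treeHittingTime,
    Kemeny.sum_degVec_mul_degVec_mul_dist, hvol, div_div]
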